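/- All C*-algebras are unital, $A\otimes B$ denotes the completed spatial tensor product, and $\mathcal S(A)$ the state space of $A$. Let $X$ be a set and $\mathcal A=\{A_x\}_{x\in X}$ a family of C*-algebras; an operator field on $\mathcal A$ is an element $f\in\prod_x A_x$, and $\|f\|_\infty:=\sup_x\|f(x)\|$. A \emph{metric operator field (mof)} on $\mathcal A$ is a family $D=(D_{x,x'})_{x,x'\in X}$, $D_{x,x'}\in A_x\otimes A_{x'}$, such that (i) there are states $\mu_x\in\mathcal S(A_x)$ with $(\mu_x\otimes\mu_x)(D_{x,x})=0$ for all $x$; (ii) $D_{x,x'}$ is positive and invertible for $x\ne x'$; (iii) $D_{x,x'}$ is the image of $D_{x',x}$ under the flip $A_{x'}\otimes A_x\to A_x\otimes A_{x'}$; (iv) $\mathfrak M D_{x,x''}\le D_{x,x'}\otimes 1_{x''}+1_x\otimes D_{x',x''}$ in $A_x\otimes A_{x'}\otimes A_{x''}$ for all $x,x',x''$, where $\mathfrak M(a\otimes c)=a\otimes 1_{x'}\otimes c$. For any family $D$ with $D_{x,x'}\in A_x\otimes A_{x'}$ satisfying (ii), put $$\|f\|_D:=\sup_{x\ne x'}\bigl\|D_{x,x'}^{-1/2}\,(f(x)\otimes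 1_{x'}-1_x\otimes f(x'))\,D_{x,x'}^{-1/2}\bigr\|\in[0,\infty].$$ Let $\mathbf L(D)$ be the space of operator fields $f$ with $\|f\|_\infty<\infty$ and $\|f\|_D<\infty$; for $x_0\in X$ let $\mathbf L_0(D)$ be the space of operator fields $f$ with $\|f\|_D<\infty$ and $f(x_0)=0$. Let $\mathbf{Lip}(D)\subseteq\mathbf L(D)$ and $\mathbf{Lip}_0(D)\subseteq\mathbf L_0(D)$ be the subspaces of those $f$ for which $f(x)\otimes 1_{x'}$ commutes with $D_{x,x'}$ for all $x,x'\in X$. \textbf{Theorem.} Let $D$ be a mof on $\mathcal A$ with $\|D\|_\infty:=\sup_{x,x'}\|D_{x,x'}\|\le 2$. Let $A_\infty$ be an arbitrary nonzero C*-algebra, let $X^+:=X\cup\{\infty\}$ with a point $\infty\notin X$ as base point, and on $\{A_p\}_{p\in X^+}$ define $D^+_{x,x'}:=D_{x,x'}$, $D^+_{\infty,x}:=1_\infty\otimes 1_x$, $D^+_{x,\infty}:=1_x\otimes 1_\infty$ for $x,x'\in X$, and $D^+_{\infty,\infty}:=0$. Then $D^+$ is a mof, and the restriction map $f\mapsto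 f|_X$ is a linear bijection from $\mathbf L_0(D^+)$ onto $\mathbf L(D)$, and likewise from $\mathbf{Lip}_0(D^+)$ onto $\mathbf{Lip}(D)$, with $$\max\{\|f|_X\|_D,\|f|_X\|_\infty\}=\|f\|_{D^+}$$ for all $f$ in the respective domain. That is, it is an isometric isomorphism of $(\mathbf L_0(D^+),\|\cdot\|_{D^+})$ onto $(\mathbf L(D),\max\{\|\cdot\|_D,\|\cdot\|_\infty\})$ and of $(\mathbf{Lip}_0(D^+),\|\cdot\|_{D^+})$ onto $(\mathbf{Lip}(D),\max\{\|\cdot\|_D,\|\cdot\|_\infty\})$. -/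

import Mathlib

universe u v

open scoped ENNReal TensorProduct ComplexOrder InnerProductSpace

noncomputable section

namespace Mof

/-! ### States and the universal representation of a unital C*-algebra -/

/-- A state of a unital C*-algebra: a positive linear functional of value one at the unit. -/
structure CState (A : Type u) [CStarAlgebra A] where
  toLin : A →ₗ[ℂ] ℂ
  nonneg : ∀ a : A, 0 ≤ toLin (star a * a)
  map_one : toLin 1 = 1

section Universal

attribute [local instance] CStarAlgebra.spectralOrder CStarAlgebra.spectralOrderedRing

variable {A : Type u} [CStarAlgebra A]

/-- A state as a positive linear map for the order of the C*-algebra. -/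
def CState.pos (φ : CState A) : A →ₚ[ℂ] ℂ :=
  PositiveLinearMap.mk₀ φ.toLin (by
    intro x hx
    obtain ⟨b, rfl⟩ := CStarAlgebra.nonneg_iff_eq_star_mul_self.mp hx
    exact φ.nonneg b)

/-- The Hilbert space of the GNS representation of a state. -/
abbrev GNSSpace (φ : CState A) : Type u := φ.pos.GNS

/-- The GNS representation of a state. -/
def gnsRep (φ : CState A) : A →⋆ₐ[ℂ] (GNSSpace φ →L[ℂ] GNSSpace φ) :=
  φ.pos.gnsStarAlgHom

/-- The canonical cyclic vector of the GNS representation (the class of the unit). -/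
def gnsVec (φ : CState A) : GNSSpace φ := ((φ.pos.toPreGNS (1 : A) : φ.pos.PreGNS) : φ.pos.GNS)

theorem inner_gnsVec (φ : CState A) (a : A) :
    ⟪gnsVec φ, gnsRep φ a (gnsVec φ)⟫_ℂ = φ.toLin a := by
  have : gnsRep φ a (gnsVec φ) = ((φ.pos.toPreGNS (a * 1) : φ.pos.PreGNS) : φ.pos.GNS) :=
    PositiveLinearMap.gnsNonUnitalStarAlgHom_apply_coe φ.pos
  rw [this, gnsVec, UniformSpace.Completion.inner_coe, PositiveLinearMap.preGNS_inner_def]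
  change φ.toLin (star (1 : A) * (a * 1)) = φ.toLin a
  rw [star_one, one_mul, mul_one]

end Universal

/-- The Hilbert space of the universal representation: the Hilbert sum of the GNS spaces of all
states. -/
def UHilb (A : Type u) [CStarAlgebra A] : Type u := lp (fun φ : CState A => GNSSpace φ) 2

instance (A : Type u) [CStarAlgebra A] : NormedAddCommGroup (UHilb A) :=
  inferInstanceAs (NormedAddCommGroup (lp (fun φ : CState A => GNSSpace φ) 2))

instance (A : Type u) [CStarAlgebra A] : InnerProductSpace ℂ (UHilb A) :=
  inferInstanceAs (InnerProductSpace ℂ (lp (fun φ : CState A => GNSSpace φ) 2))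

instance (A : Type u) [CStarAlgebra A] : CompleteSpace (UHilb A) :=
  inferInstanceAs (CompleteSpace (lp (fun φ : CState A => GNSSpace φ) 2))

section DirectSum

variable {ι : Type u} {E : ι → Type u} [∀ i, NormedAddCommGroup (E i)]
  [∀ i, InnerProductSpace ℂ (E i)]

theorem dirSum_aux (T : ∀ i, E i →L[ℂ] E i) (C : ℝ) (hT : ∀ i, ‖T i‖ ≤ C) (ξ : lp E 2) (i : ι) :
    ‖T i (ξ i)‖ ^ (2 : ℝ≥0∞).toReal ≤ C ^ 2 * ‖ξ i‖ ^ (2 : ℝ≥0∞).toReal := by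
  have h1 : ‖T i (ξ i)‖ ≤ C * ‖ξ i‖ :=
    ((T i).le_opNorm _).trans (mul_le_mul_of_nonneg_right (hT i) (norm_nonneg _))
  have h2 : ‖T i (ξ i)‖ ^ 2 ≤ (C * ‖ξ i‖) ^ 2 := pow_le_pow_left₀ (norm_nonneg _) h1 2
  simpa [mul_pow] using h2

theorem two_toReal_pos : 0 < (2 : ℝ≥0∞).toReal := by norm_num

theorem dirSum_mem (T : ∀ i, E i →L[ℂ] E i) (C : ℝ) (hT : ∀ i, ‖T i‖ ≤ C) (ξ : lp E 2) :
    Memℓp (fun i => T i (ξ i)) 2 :=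
  memℓp_gen (Summable.of_nonneg_of_le (fun i => by positivity) (dirSum_aux T C hT ξ)
    (((lp.memℓp ξ).summable two_toReal_pos).mul_left _))

/-- The diagonal operator `(ξ i) ↦ (T i (ξ i))` on a Hilbert sum, for a bounded family `T`. -/
def dirSumOp (T : ∀ i, E i →L[ℂ] E i) (C : ℝ) (hC : 0 ≤ C) (hT : ∀ i, ‖T i‖ ≤ C) :
    lp E 2 →L[ℂ] lp E 2 :=
  LinearMap.mkContinuous
    { toFun := fun ξ => ⟨fun i => T i (ξ i), dirSum_mem T C hT ξ⟩
      map_add' := fun ξ η => by ext i; exact map_add (T i) (ξ i) (η i)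
      map_smul' := fun c ξ => by ext i; exact map_smul (T i) c (ξ i) } C (by
    intro ξ
    refine lp.norm_le_of_tsum_le two_toReal_pos (by positivity) ?_
    have hs := (lp.memℓp ξ).summable two_toReal_pos
    calc _ ≤ ∑' i, C ^ 2 * ‖ξ i‖ ^ (2 : ℝ≥0∞).toReal :=
          Summable.tsum_le_tsum (dirSum_aux T C hT ξ)
            ((dirSum_mem T C hT ξ).summable two_toReal_pos) (hs.mul_left _)
      _ = C ^ 2 * ‖ξ‖ ^ (2 : ℝ≥0∞).toReal := by
          rw [tsum_mul_left, lp.norm_rpow_eq_tsum two_toReal_pos]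
      _ = _ := by simp [mul_pow])

@[simp] theorem dirSumOp_apply (T : ∀ i, E i →L[ℂ] E i) (C : ℝ) (hC : 0 ≤ C)
    (hT : ∀ i, ‖T i‖ ≤ C) (ξ : lp E 2) (i : ι) : dirSumOp T C hC hT ξ i = T i (ξ i) := rfl

end DirectSum

section UniversalRep

variable {A : Type u} [CStarAlgebra A]

theorem norm_gnsRep_le (φ : CState A) (a : A) : ‖gnsRep φ a‖ ≤ ‖a‖ :=
  NonUnitalStarAlgHom.norm_apply_le (gnsRep φ) a

variable (A) in
/-- The direct sum of the GNS representations of all states. -/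
def sumRep : A →⋆ₐ[ℂ] (lp (fun φ : CState A => GNSSpace φ) 2 →L[ℂ]
    lp (fun φ : CState A => GNSSpace φ) 2) where
  toFun a := dirSumOp (fun φ : CState A => gnsRep φ a) ‖a‖ (norm_nonneg a)
    (fun φ => norm_gnsRep_le φ a)
  map_one' := by ext ξ φ; simp
  map_mul' a b := by ext ξ φ; simp
  map_zero' := by ext ξ φ; simp
  map_add' a b := by ext ξ φ; simp
  commutes' c := by ext ξ φ; simp [Algebra.algebraMap_eq_smul_one]
  map_star' a := by
    rw [ContinuousLinearMap.star_eq_adjoint, ContinuousLinearMap.eq_adjoint_iff]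
    intro ξ η
    rw [lp.inner_eq_tsum, lp.inner_eq_tsum]
    refine tsum_congr fun φ => ?_
    rw [dirSumOp_apply, dirSumOp_apply, map_star, ContinuousLinearMap.star_eq_adjoint,
      ContinuousLinearMap.adjoint_inner_left]

theorem sumRep_apply (a : A) (ξ : lp (fun φ : CState A => GNSSpace φ) 2) (φ : CState A) :
    sumRep A a ξ φ = gnsRep φ a (ξ φ) := rfl

variable (A) in
/-- The universal representation of a C*-algebra, on its Hilbert space `UHilb A`: the direct sum
of the GNS representations of all states.  It is faithful. -/
def univRep : A →⋆ₐ[ℂ] (UHilb A →L[ℂ] UHilb A) := sumRep A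

open Classical in
/-- The unit vector of the universal representation that implements the state `φ`. -/
def stateVec (φ : CState A) : UHilb A :=
  (lp.single 2 φ (gnsVec φ) : lp (fun φ : CState A => GNSSpace φ) 2)

theorem inner_stateVec (φ : CState A) (a : A) :
    ⟪stateVec φ, univRep A a (stateVec φ)⟫_ℂ = φ.toLin a := by
  classical
  change ⟪(lp.single 2 φ (gnsVec φ) : lp (fun φ : CState A => GNSSpace φ) 2),
    sumRep A a (lp.single 2 φ (gnsVec φ))⟫_ℂ = φ.toLin a
  rw [lp.inner_single_left, sumRep_apply, lp.coeFn_single, Pi.single_eq_same, inner_gnsVec]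

end UniversalRep

/-! ### Hilbert tensor products and the operators on them -/

section HilbertTensor

variable (H K L : Type u) [NormedAddCommGroup H] [InnerProductSpace ℂ H]
  [NormedAddCommGroup K] [InnerProductSpace ℂ K] [NormedAddCommGroup L] [InnerProductSpace ℂ L]

/-- The Hilbert space tensor product. -/
def HTens : Type u := UniformSpace.Completion (H ⊗[ℂ] K)

instance : NormedAddCommGroup (HTens H K) :=
  inferInstanceAs (NormedAddCommGroup (UniformSpace.Completion (H ⊗[ℂ] K)))

instance : InnerProductSpace ℂ (HTens H K) :=
  inferInstanceAs (InnerProductSpace ℂ (UniformSpace.Completion (H ⊗[ℂ] K)))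

instance : CompleteSpace (HTens H K) :=
  inferInstanceAs (CompleteSpace (UniformSpace.Completion (H ⊗[ℂ] K)))

/-- The algebraic tensor product inside the Hilbert tensor product. -/
def inc : H ⊗[ℂ] K →ₗᵢ[ℂ] HTens H K :=
  (UniformSpace.Completion.toComplₗᵢ : H ⊗[ℂ] K →ₗᵢ[ℂ] UniformSpace.Completion (H ⊗[ℂ] K))

variable {H K L}

/-- The elementary tensor of two vectors. -/
def vtens (ξ : H) (η : K) : HTens H K := inc H K (ξ ⊗ₜ[ℂ] η)

/-- The tensor product of two bounded operators. -/
def opTens (S : H →L[ℂ] H) (T : K →L[ℂ] K) : HTens H K →L[ℂ] HTens H K :=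
  ((TensorProduct.mapL S T).completion :
    UniformSpace.Completion (H ⊗[ℂ] K) →L[ℂ] UniformSpace.Completion (H ⊗[ℂ] K))

theorem opTens_inc (S : H →L[ℂ] H) (T : K →L[ℂ] K) (x : H ⊗[ℂ] K) :
    opTens S T (inc H K x) = inc H K (TensorProduct.mapL S T x) :=
  ContinuousLinearMap.completion_apply_coe _ _

theorem opTens_vtens (S : H →L[ℂ] H) (T : K →L[ℂ] K) (ξ : H) (η : K) :
    opTens S T (vtens ξ η) = vtens (S ξ) (T η) := by
  rw [vtens, opTens_inc, TensorProduct.mapL_tmul, vtens]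

theorem ext_inc {S T : HTens H K →L[ℂ] HTens H K}
    (h : ∀ x : H ⊗[ℂ] K, S (inc H K x) = T (inc H K x)) : S = T := by
  have hd : DenseRange (inc H K) := UniformSpace.Completion.denseRange_coe
  exact DFunLike.coe_injective (hd.equalizer S.continuous T.continuous (funext h))

theorem opTens_add_left (S S₁ : H →L[ℂ] H) (T : K →L[ℂ] K) :
    opTens (S + S₁) T = opTens S T + opTens S₁ T := by
  refine ext_inc fun x => ?_
  rw [add_apply, opTens_inc, opTens_inc, opTens_inc, TensorProduct.mapL_add_left,
    add_apply, map_add]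

theorem opTens_add_right (S : H →L[ℂ] H) (T T₁ : K →L[ℂ] K) :
    opTens S (T + T₁) = opTens S T + opTens S T₁ := by
  refine ext_inc fun x => ?_
  rw [add_apply, opTens_inc, opTens_inc, opTens_inc, TensorProduct.mapL_add_right,
    add_apply, map_add]

theorem opTens_smul_left (c : ℂ) (S : H →L[ℂ] H) (T : K →L[ℂ] K) :
    opTens (c • S) T = c • opTens S T := by
  refine ext_inc fun x => ?_
  rw [smul_apply, opTens_inc, opTens_inc, TensorProduct.mapL_smul_left, smul_apply, map_smul]

theorem opTens_smul_right (c : ℂ) (S : H →L[ℂ] H) (T : K →L[ℂ] K) :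
    opTens S (c • T) = c • opTens S T := by
  refine ext_inc fun x => ?_
  rw [smul_apply, opTens_inc, opTens_inc, TensorProduct.mapL_smul_right, smul_apply, map_smul]

theorem inc_dense : DenseRange (inc H K) := UniformSpace.Completion.denseRange_coe

variable (H K) in
/-- The unitary flip `ξ ⊗ η ↦ η ⊗ ξ`. -/
def flipU : HTens H K ≃ₗᵢ[ℂ] HTens K H :=
  LinearEquiv.extendOfIsometry (TensorProduct.comm ℂ H K) (inc H K).toLinearMap
    (inc K H).toLinearMap inc_dense inc_dense (by
      intro x
      simp)

theorem flipU_vtens (ξ : H) (η : K) : flipU H K (vtens ξ η) = vtens η ξ :=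
  LinearEquiv.extendOfIsometry_eq (TensorProduct.comm ℂ H K) (inc H K).toLinearMap
    (inc K H).toLinearMap inc_dense inc_dense _ (ξ ⊗ₜ[ℂ] η)

/-- The algebraic triple tensor product inside `(H ⊗ K) ⊗ L`. -/
def incL (H K L : Type u) [NormedAddCommGroup H] [InnerProductSpace ℂ H]
    [NormedAddCommGroup K] [InnerProductSpace ℂ K] [NormedAddCommGroup L]
    [InnerProductSpace ℂ L] : (H ⊗[ℂ] K) ⊗[ℂ] L →ₗᵢ[ℂ] HTens (HTens H K) L :=
  (inc (HTens H K) L).comp (TensorProduct.mapIsometry (inc H K) LinearIsometry.id)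

/-- The algebraic triple tensor product inside `H ⊗ (K ⊗ L)`. -/
def incR (H K L : Type u) [NormedAddCommGroup H] [InnerProductSpace ℂ H]
    [NormedAddCommGroup K] [InnerProductSpace ℂ K] [NormedAddCommGroup L]
    [InnerProductSpace ℂ L] : H ⊗[ℂ] (K ⊗[ℂ] L) →ₗᵢ[ℂ] HTens H (HTens K L) :=
  (inc H (HTens K L)).comp (TensorProduct.mapIsometry LinearIsometry.id (inc K L))

theorem mapIsometry_dense {H₁ K₁ : Type u} [NormedAddCommGroup H₁] [InnerProductSpace ℂ H₁]
    [NormedAddCommGroup K₁] [InnerProductSpace ℂ K₁] (f : H →ₗᵢ[ℂ] H₁) (g : K →ₗᵢ[ℂ] K₁)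
    (hf : DenseRange f) (hg : DenseRange g) : DenseRange (TensorProduct.mapIsometry f g) := by
  have key : ∀ z : H₁ ⊗[ℂ] K₁, z ∈ closure (Set.range (TensorProduct.mapIsometry f g)) := by
    intro z
    have hcl : closure (Set.range (TensorProduct.mapIsometry f g)) =
        ((LinearMap.range (TensorProduct.mapIsometry f g).toLinearMap).topologicalClosure :
          Set (H₁ ⊗[ℂ] K₁)) := rfl
    rw [hcl]
    induction z using TensorProduct.induction_on with
    | zero => exact zero_mem _
    | add a b ha hb => exact add_mem ha hb
    | tmul ξ η =>
      refine isClosed_closure.mem_of_frequently_of_tendsto (b := Filter.map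
        (fun p : H₁ × K₁ => p.1 ⊗ₜ[ℂ] p.2) (nhdsWithin (ξ, η) (Set.range (Prod.map f g)))) ?_
        (f := id) ?_
      · have : (nhdsWithin (ξ, η) (Set.range (Prod.map f g))).NeBot :=
          mem_closure_iff_nhdsWithin_neBot.mp ((hf.prodMap hg) (ξ, η))
        refine Filter.Eventually.frequently ?_
        rw [Filter.eventually_map]
        filter_upwards [self_mem_nhdsWithin] with p hp
        obtain ⟨⟨x, y⟩, rfl⟩ := hp
        exact subset_closure ⟨x ⊗ₜ[ℂ] y, by simp⟩
      · exact (TensorProduct.continuous_tmul.tendsto (ξ, η)).mono_left nhdsWithin_le_nhds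
  exact key

theorem id_dense : DenseRange (LinearIsometry.id : H →ₗᵢ[ℂ] H) :=
  Function.Surjective.denseRange fun x => ⟨x, rfl⟩

theorem incL_dense : DenseRange (incL H K L) :=
  (inc_dense (H := HTens H K) (K := L)).comp (mapIsometry_dense _ _ inc_dense id_dense)
    (inc (HTens H K) L).continuous

theorem incR_dense : DenseRange (incR H K L) :=
  (inc_dense (H := H) (K := HTens K L)).comp (mapIsometry_dense _ _ id_dense inc_dense)
    (inc H (HTens K L)).continuous

variable (H K L) in
/-- The unitary associator `(ξ ⊗ η) ⊗ ζ ↦ ξ ⊗ (η ⊗ ζ)`. -/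
def assocU : HTens (HTens H K) L ≃ₗᵢ[ℂ] HTens H (HTens K L) :=
  LinearEquiv.extendOfIsometry (TensorProduct.assoc ℂ H K L) (incL H K L).toLinearMap
    (incR H K L).toLinearMap incL_dense incR_dense (by
      intro x
      rw [LinearIsometry.coe_toLinearMap, LinearIsometry.coe_toLinearMap, LinearIsometry.norm_map,
        LinearIsometry.norm_map, TensorProduct.norm_assoc])

theorem assocU_vtens (ξ : H) (η : K) (ζ : L) :
    assocU H K L (vtens (vtens ξ η) ζ) = vtens ξ (vtens η ζ) :=
  LinearEquiv.extendOfIsometry_eq (TensorProduct.assoc ℂ H K L) (incL H K L).toLinearMap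
    (incR H K L).toLinearMap incL_dense incR_dense _ ((ξ ⊗ₜ[ℂ] η) ⊗ₜ[ℂ] ζ)

/-- The flip `S ⊗ T ↦ T ⊗ S` of operators. -/
def flipOp : (HTens H K →L[ℂ] HTens H K) ≃⋆ₐ[ℂ] (HTens K H →L[ℂ] HTens K H) :=
  (flipU H K).conjStarAlgEquiv

variable (L) in
/-- `T ↦ T ⊗ 1`, an operator on the first two legs of a triple tensor product. -/
def leg12 (T : HTens H K →L[ℂ] HTens H K) :
    HTens H (HTens K L) →L[ℂ] HTens H (HTens K L) :=
  (assocU H K L).conjStarAlgEquiv (opTens T 1)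

variable (H) in
/-- `T ↦ 1 ⊗ T`, an operator on the last two legs of a triple tensor product. -/
def leg23 (T : HTens K L →L[ℂ] HTens K L) :
    HTens H (HTens K L) →L[ℂ] HTens H (HTens K L) :=
  opTens 1 T

variable (H) in
/-- The unitary `ξ ⊗ ω ↦ ξ ⊗ U ω` for a unitary `U`. -/
def congrU {F G : Type u} [NormedAddCommGroup F] [InnerProductSpace ℂ F]
    [NormedAddCommGroup G] [InnerProductSpace ℂ G] (U : F ≃ₗᵢ[ℂ] G) : HTens H F ≃ₗᵢ[ℂ] HTens H G :=
  LinearEquiv.extendOfIsometry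
    (TensorProduct.congrIsometry (LinearIsometryEquiv.refl ℂ H) U).toLinearEquiv
    (inc H F).toLinearMap (inc H G).toLinearMap inc_dense inc_dense (by
      intro x
      simp only [LinearIsometry.coe_toLinearMap, LinearIsometry.norm_map,
        LinearIsometryEquiv.coe_toLinearEquiv, LinearIsometryEquiv.norm_map])

theorem congrU_vtens {F G : Type u} [NormedAddCommGroup F] [InnerProductSpace ℂ F]
    [NormedAddCommGroup G] [InnerProductSpace ℂ G] (U : F ≃ₗᵢ[ℂ] G) (ξ : H) (ω : F) :
    congrU H U (vtens ξ ω) = vtens ξ (U ω) :=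
  LinearEquiv.extendOfIsometry_eq
    (TensorProduct.congrIsometry (LinearIsometryEquiv.refl ℂ H) U).toLinearEquiv
    (inc H F).toLinearMap (inc H G).toLinearMap inc_dense inc_dense _ (ξ ⊗ₜ[ℂ] ω)

variable (K) in
/-- `S ⊗ T ↦ S ⊗ 1 ⊗ T`: an operator on the outer two legs of a triple tensor product. -/
def leg13 (T : HTens H L →L[ℂ] HTens H L) :
    HTens H (HTens K L) →L[ℂ] HTens H (HTens K L) :=
  (congrU H (flipU L K)).conjStarAlgEquiv (leg12 K T)

theorem flipOp_opTens_vtens (S : H →L[ℂ] H) (T : K →L[ℂ] K) (ξ : H) (η : K) :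
    flipOp (opTens S T) (vtens η ξ) = vtens (T η) (S ξ) := by
  rw [flipOp, LinearIsometryEquiv.conjStarAlgEquiv_apply_apply]
  have h : (flipU H K).symm (vtens η ξ) = vtens ξ η := by
    rw [LinearIsometryEquiv.symm_apply_eq, flipU_vtens]
  rw [h, opTens_vtens, flipU_vtens]

theorem leg12_opTens_vtens (S : H →L[ℂ] H) (T : K →L[ℂ] K) (ξ : H) (η : K) (ζ : L) :
    leg12 L (opTens S T) (vtens ξ (vtens η ζ)) = vtens (S ξ) (vtens (T η) ζ) := by
  rw [leg12, LinearIsometryEquiv.conjStarAlgEquiv_apply_apply]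
  have h : (assocU H K L).symm (vtens ξ (vtens η ζ)) = vtens (vtens ξ η) ζ := by
    rw [LinearIsometryEquiv.symm_apply_eq, assocU_vtens]
  rw [h, opTens_vtens, opTens_vtens, assocU_vtens, one_apply_eq_self]

theorem leg23_opTens_vtens (S : K →L[ℂ] K) (T : L →L[ℂ] L) (ξ : H) (η : K) (ζ : L) :
    leg23 H (opTens S T) (vtens ξ (vtens η ζ)) = vtens ξ (vtens (S η) (T ζ)) := by
  rw [leg23, opTens_vtens, opTens_vtens, one_apply_eq_self]

theorem leg13_opTens_vtens (S : H →L[ℂ] H) (T : L →L[ℂ] L) (ξ : H) (η : K) (ζ : L) :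
    leg13 K (opTens S T) (vtens ξ (vtens η ζ)) = vtens (S ξ) (vtens η (T ζ)) := by
  rw [leg13, LinearIsometryEquiv.conjStarAlgEquiv_apply_apply]
  have h : (congrU H (flipU L K)).symm (vtens ξ (vtens η ζ)) = vtens ξ (vtens ζ η) := by
    rw [LinearIsometryEquiv.symm_apply_eq, congrU_vtens, flipU_vtens]
  rw [h, leg12_opTens_vtens, congrU_vtens, flipU_vtens]

end HilbertTensor

/-! ### The completed spatial tensor product -/

section Spatial

variable (A B : Type u) [CStarAlgebra A] [CStarAlgebra B]

/-- The bounded operators on the Hilbert tensor product of the universal representation spaces. -/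
abbrev TensOps : Type u := HTens (UHilb A) (UHilb B) →L[ℂ] HTens (UHilb A) (UHilb B)

/-- The completed spatial tensor product of two C*-algebras: the C*-algebra generated by the
operators `a ⊗ b` in the (faithful) universal representations of the factors. -/
def Spatial : StarSubalgebra ℂ (TensOps A B) :=
  (StarAlgebra.adjoin ℂ
    {T | ∃ (a : A) (b : B), T = opTens (univRep A a) (univRep B b)}).topologicalClosure

theorem isClosed_spatial : IsClosed (Spatial A B : Set (TensOps A B)) :=
  StarSubalgebra.isClosed_topologicalClosure _

variable {A B}

/-- The elementary tensor `a ⊗ b`. -/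
def tmul (a : A) (b : B) : Spatial A B :=
  ⟨opTens (univRep A a) (univRep B b),
    StarSubalgebra.le_topologicalClosure _ (StarAlgebra.subset_adjoin ℂ _ ⟨a, b, rfl⟩)⟩

/-- The product state `φ ⊗ ψ`. -/
def prodState (φ : CState A) (ψ : CState B) (T : Spatial A B) : ℂ :=
  ⟪vtens (stateVec φ) (stateVec ψ), (T : TensOps A B) (vtens (stateVec φ) (stateVec ψ))⟫_ℂ

theorem prodState_tmul (φ : CState A) (ψ : CState B) (a : A) (b : B) :
    prodState φ ψ (tmul a b) = φ.toLin a * ψ.toLin b := by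
  rw [prodState, tmul, opTens_vtens, vtens, vtens, LinearIsometry.inner_map_map,
    TensorProduct.inner_tmul, inner_stateVec, inner_stateVec]

theorem tmul_add_left (a a' : A) (b : B) : tmul (a + a') b = tmul a b + tmul a' b :=
  Subtype.ext (by simp [tmul, opTens_add_left])

theorem tmul_add_right (a : A) (b b' : B) : tmul a (b + b') = tmul a b + tmul a b' :=
  Subtype.ext (by simp [tmul, opTens_add_right])

theorem tmul_smul_left (c : ℂ) (a : A) (b : B) : tmul (c • a) b = c • tmul a b :=
  Subtype.ext (by simp [tmul, opTens_smul_left])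

theorem tmul_smul_right (c : ℂ) (a : A) (b : B) : tmul a (c • b) = c • tmul a b :=
  Subtype.ext (by simp [tmul, opTens_smul_right])

end Spatial

/-! ### Metric operator fields -/

section Fields

variable {X : Type v} (A : X → Type u) [∀ x, CStarAlgebra (A x)]

/-- Operator fields on the bundle `A ⊗ A` over `X × X`. -/
abbrev Field₂ : Type (max u v) := ∀ x y : X, Spatial (A x) (A y)

variable {A}

/-- There are states `μ x` (metric-states) with `(μ x ⊗ μ x) (D x x) = 0` for all `x`. -/
def HasMetricStates (D : Field₂ A) : Prop :=
  ∃ μ : ∀ x, CState (A x), ∀ x, prodState (μ x) (μ x) (D x x) = 0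

/-- The operator triangle inequality, in the spatial tensor product of three fibres.  The order of
a C*-algebra of operators is the restriction of the order of operators. -/
def TriangleIneq (D : Field₂ A) : Prop :=
  ∀ x y z,
    leg13 (UHilb (A y)) (D x z : TensOps (A x) (A z)) ≤
      leg12 (UHilb (A z)) (D x y : TensOps (A x) (A y)) +
        leg23 (UHilb (A x)) (D y z : TensOps (A y) (A z))

/-- Metric operator fields: existence of metric-states, positivity and invertibility off the
diagonal, symmetry under the flip, and the triangle inequality. -/
def IsMof (D : Field₂ A) : Prop :=
  HasMetricStates D ∧
  (∀ x y, x ≠ y → 0 ≤ (D x y : TensOps (A x) (A y)) ∧ IsUnit (D x y)) ∧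
  (∀ x y, (D x y : TensOps (A x) (A y)) = flipOp (D y x : TensOps (A y) (A x))) ∧
  TriangleIneq D

/-- The supremum norm of an operator field on `A`. -/
def supNorm (f : ∀ x, A x) : ℝ≥0∞ := ⨆ x, ‖f x‖ₑ

/-- The supremum norm of an operator field on `A ⊗ A`. -/
def supNorm₂ (D : Field₂ A) : ℝ≥0∞ := ⨆ x, ⨆ y, ‖D x y‖ₑ

/-- The operator `D(x,y)^(-1/2) (f(x) ⊗ 1 - 1 ⊗ f(y)) D(x,y)^(-1/2)`. -/
def deLeeuw (D : Field₂ A) (f : ∀ x, A x) (x y : X) : TensOps (A x) (A y) :=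
  (D x y : TensOps (A x) (A y)) ^ (-(1 / 2) : ℝ) *
    ((tmul (f x) 1 - tmul 1 (f y) : Spatial (A x) (A y)) : TensOps (A x) (A y)) *
      (D x y : TensOps (A x) (A y)) ^ (-(1 / 2) : ℝ)

/-- The Lipschitz seminorm of an operator field, which may be infinite. -/
def lipSeminorm (D : Field₂ A) (f : ∀ x, A x) : ℝ≥0∞ :=
  ⨆ x, ⨆ y, ⨆ _ : x ≠ y, ‖deLeeuw D f x y‖ₑ

/-- The norm `max (‖f‖_D, ‖f‖_∞)`. -/
def lipNorm' (D : Field₂ A) (f : ∀ x, A x) : ℝ≥0∞ := max (lipSeminorm D f) (supNorm f)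

/-- The operator field `f` commutes with `D`. -/
def Commutes (D : Field₂ A) (f : ∀ x, A x) : Prop :=
  ∀ x y, Commute (D x y) (tmul (f x) 1)

theorem supNorm_add_le (f g : ∀ x, A x) : supNorm (f + g) ≤ supNorm f + supNorm g :=
  iSup_le fun x => (enorm_add_le _ _).trans
    (add_le_add (le_iSup (fun x => ‖f x‖ₑ) x) (le_iSup (fun x => ‖g x‖ₑ) x))

theorem supNorm_smul_le (c : ℂ) (f : ∀ x, A x) : supNorm (c • f) ≤ ‖c‖ₑ * supNorm f :=
  iSup_le fun x => by
    rw [Pi.smul_apply, enorm_smul]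
    exact mul_le_mul_right (le_iSup (fun x => ‖f x‖ₑ) x) _

theorem deLeeuw_add (D : Field₂ A) (f g : ∀ x, A x) (x y : X) :
    deLeeuw D (f + g) x y = deLeeuw D f x y + deLeeuw D g x y := by
  have h : (tmul ((f + g) x) 1 - tmul 1 ((f + g) y) : Spatial (A x) (A y)) =
      (tmul (f x) 1 - tmul 1 (f y)) + (tmul (g x) 1 - tmul 1 (g y)) := by
    rw [Pi.add_apply, Pi.add_apply, tmul_add_left, tmul_add_right]
    abel
  rw [deLeeuw, h, AddMemClass.coe_add, mul_add, add_mul]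
  rfl

theorem deLeeuw_smul (D : Field₂ A) (c : ℂ) (f : ∀ x, A x) (x y : X) :
    deLeeuw D (c • f) x y = c • deLeeuw D f x y := by
  have h : (tmul ((c • f) x) 1 - tmul 1 ((c • f) y) : Spatial (A x) (A y)) =
      c • (tmul (f x) 1 - tmul 1 (f y)) := by
    rw [Pi.smul_apply, Pi.smul_apply, tmul_smul_left, tmul_smul_right, smul_sub]
  rw [deLeeuw, h, SetLike.val_smul, mul_smul_comm, smul_mul_assoc]
  rfl

theorem le_lipSeminorm (D : Field₂ A) (f : ∀ x, A x) {x y : X} (h : x ≠ y) :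
    ‖deLeeuw D f x y‖ₑ ≤ lipSeminorm D f :=
  le_iSup_of_le x (le_iSup_of_le y (le_iSup_of_le h le_rfl))

theorem lipSeminorm_add_le (D : Field₂ A) (f g : ∀ x, A x) :
    lipSeminorm D (f + g) ≤ lipSeminorm D f + lipSeminorm D g :=
  iSup_le fun x => iSup_le fun y => iSup_le fun h => by
    rw [deLeeuw_add]
    exact (enorm_add_le _ _).trans (add_le_add (le_lipSeminorm D f h) (le_lipSeminorm D g h))

theorem lipSeminorm_smul_le (D : Field₂ A) (c : ℂ) (f : ∀ x, A x) :
    lipSeminorm D (c • f) ≤ ‖c‖ₑ * lipSeminorm D f :=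
  iSup_le fun x => iSup_le fun y => iSup_le fun h => by
    rw [deLeeuw_smul, enorm_smul]
    exact mul_le_mul_right (le_lipSeminorm D f h) _

theorem lipSeminorm_zero (D : Field₂ A) : lipSeminorm D 0 = 0 := by
  have := lipSeminorm_smul_le D 0 0
  simpa using this

theorem supNorm_zero : supNorm (0 : ∀ x, A x) = 0 := by
  have := supNorm_smul_le 0 (0 : ∀ x, A x)
  simpa using this

/-- The Lipschitz space of `D`: the bounded Lipschitz operator fields. -/
def lipSpace (D : Field₂ A) : Submodule ℂ (∀ x, A x) where
  carrier := {f | supNorm f < ⊤ ∧ lipSeminorm D f < ⊤}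
  add_mem' hf hg := ⟨(supNorm_add_le _ _).trans_lt (ENNReal.add_lt_top.2 ⟨hf.1, hg.1⟩),
    (lipSeminorm_add_le D _ _).trans_lt (ENNReal.add_lt_top.2 ⟨hf.2, hg.2⟩)⟩
  zero_mem' := by simp [supNorm_zero, lipSeminorm_zero]
  smul_mem' c _ hf := ⟨(supNorm_smul_le c _).trans_lt (ENNReal.mul_lt_top enorm_lt_top hf.1),
    (lipSeminorm_smul_le D c _).trans_lt (ENNReal.mul_lt_top enorm_lt_top hf.2)⟩

/-- The Lipschitz operator fields that vanish at the base point `x₀`. -/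
def lipSpace₀ (D : Field₂ A) (x₀ : X) : Submodule ℂ (∀ x, A x) where
  carrier := {f | lipSeminorm D f < ⊤ ∧ f x₀ = 0}
  add_mem' hf hg := ⟨(lipSeminorm_add_le D _ _).trans_lt (ENNReal.add_lt_top.2 ⟨hf.1, hg.1⟩),
    by rw [Pi.add_apply, hf.2, hg.2, add_zero]⟩
  zero_mem' := by simp [lipSeminorm_zero]
  smul_mem' c _ hf := ⟨(lipSeminorm_smul_le D c _).trans_lt
    (ENNReal.mul_lt_top enorm_lt_top hf.1), by rw [Pi.smul_apply, hf.2, smul_zero]⟩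

/-- The operator fields that commute with `D`. -/
def commSpace (D : Field₂ A) : Submodule ℂ (∀ x, A x) where
  carrier := {f | Commutes D f}
  add_mem' hf hg x y := by
    rw [Pi.add_apply, tmul_add_left]
    exact (hf x y).add_right (hg x y)
  zero_mem' x y := by
    have h : (tmul ((0 : ∀ x, A x) x) 1 : Spatial (A x) (A y)) = 0 := by
      simpa using tmul_smul_left (0 : ℂ) (0 : A x) (1 : A y)
    rw [h]
    exact Commute.zero_right _
  smul_mem' c f hf x y := by
    rw [Pi.smul_apply, tmul_smul_left]
    exact (hf x y).smul_right c

/-- The Lipschitz algebra of `D`. -/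
def lipAlg (D : Field₂ A) : Submodule ℂ (∀ x, A x) := lipSpace D ⊓ commSpace D

/-- The elements of `lipSpace₀ D x₀` that commute with `D`. -/
def lipAlg₀ (D : Field₂ A) (x₀ : X) : Submodule ℂ (∀ x, A x) := lipSpace₀ D x₀ ⊓ commSpace D

end Fields

/-! ### The one-point extension -/

section Extension

variable {X : Type v} (A : X → Type u) (B : Type u)

/-- The bundle over `X ∪ {∞}` (with `none` as the point `∞`) that extends `A` by the fibre `B`. -/
def bundlePlus : Option X → Type u
  | none => B
  | some x => A x

variable [hA : ∀ x, CStarAlgebra (A x)] [hB : CStarAlgebra B]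

instance instBundlePlus : ∀ p : Option X, CStarAlgebra (bundlePlus A B p)
  | none => hB
  | some x => hA x

variable {A}

/-- The one-point extension of an operator field on `A ⊗ A`. -/
def mofPlus (D : Field₂ A) : Field₂ (bundlePlus A B)
  | some x, some y => D x y
  | some _, none => 1
  | none, some _ => 1
  | none, none => 0

variable (A) in
/-- The restriction of operator fields from `X ∪ {∞}` to `X`. -/
def restrictPlus : (∀ p : Option X, bundlePlus A B p) →ₗ[ℂ] ∀ x, A x where
  toFun f x := f (some x)
  map_add' _ _ := rfl
  map_smul' _ _ := rfl

end Extension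

end Mof

end

noncomputable section

namespace Mof

/-! ### Existence of states and faithfulness of the universal representation -/

section States

variable {A : Type u} [CStarAlgebra A]

/-! The isometry is a computation at the new pairs. There `D⁺` is the unit, so its power `-1/2` is
the unit too, and for `f(∞) = 0` the de Leeuw operator is `f(x) ⊗ 1` or `-(1 ⊗ f(x))`, of norm
`‖f(x)‖`. Thus the supremum defining `‖f‖_{D⁺}` splits into the pairs inside `X`, giving `‖f|_X‖_D`,
and the pairs meeting `∞`, giving `‖f|_X‖_∞` (`lipNorm'_restrictPlus`). Extension by zero inverts
restriction, and commutation with `D⁺` is automatic at the new pairs, where `D⁺` is `1` or `0`.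

The norm equality `‖a ⊗ 1‖ = ‖a‖` needs the universal representation to be faithful, hence enough
states (`exists_state_star_mul_self`), and amplifications to be isometric on nonzero Hilbert spaces.

That `D⁺` is a mof comes down to the triangle inequality. The triple `x, ∞, z` says `D x z ≤ 1 + 1`,
which is the norm bound. The triples `x, y, ∞` and `∞, y, z` require `D ≥ 0` also on the diagonal.
This is not an axiom: it follows from flip symmetry and the triangle inequality on three equal legs
(`nonneg_of_flip_of_triangle`). -/

/-- Shifting `h` by `it` raises the square of its norm by at most `t²`, while `|g(h + it)|²`
contains `t²` and the cross term `2t · Im g(h)`. That cross term therefore stays bounded for all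
real `t`. -/
theorem im_apply_eq_zero_of_isSelfAdjoint (g : StrongDual ℂ A) (hg : ‖g‖ ≤ 1) (h1 : g 1 = 1)
    {h : A} (hh : IsSelfAdjoint h) : (g h).im = 0 := by
  have key : ∀ t : ℝ, 2 * t * (g h).im ≤ ‖h‖ ^ 2 := by
    intro t
    set k : A := h + (t * Complex.I : ℂ) • (1 : A) with hk
    have hgk : g k = g h + t * Complex.I := by simp [hk, h1]
    have hkk : star k * k = h * h + ((t ^ 2 : ℝ) : ℂ) • (1 : A) := by
      have : star k = h - (t * Complex.I : ℂ) • (1 : A) := by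
        simp [hk, hh.star_eq, sub_eq_add_neg]
      rw [this, hk, sub_mul, mul_add, mul_add]
      simp only [smul_mul_assoc, one_mul, mul_smul_comm, mul_one, smul_smul]
      have e : (t * Complex.I : ℂ) * (t * Complex.I) = -((t ^ 2 : ℝ) : ℂ) := by
        push_cast
        linear_combination (t : ℂ) ^ 2 * Complex.I_sq
      rw [e, neg_smul]
      abel
    have hone : ‖(1 : A)‖ ≤ 1 := by
      rcases subsingleton_or_nontrivial A with hA | hA
      · rw [Subsingleton.elim (1 : A) 0, norm_zero]
        exact zero_le_one
      · exact CStarRing.norm_one.le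
    have hb : ‖k‖ ^ 2 ≤ ‖h‖ ^ 2 + t ^ 2 := by
      rw [sq, ← CStarRing.norm_star_mul_self, hkk]
      refine (norm_add_le _ _).trans (add_le_add ?_ ?_)
      · rw [sq]
        exact norm_mul_le _ _
      · rw [norm_smul, Complex.norm_real, Real.norm_of_nonneg (sq_nonneg t)]
        exact mul_le_of_le_one_right (sq_nonneg t) hone
    have hc : ‖g k‖ ≤ ‖k‖ := (g.le_opNorm k).trans (mul_le_of_le_one_left (norm_nonneg _) hg)
    have hd : ‖g k‖ ^ 2 = (g h).re ^ 2 + ((g h).im + t) ^ 2 := by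
      rw [hgk, ← Complex.normSq_eq_norm_sq, Complex.normSq_apply]
      simp
      ring
    have he := pow_le_pow_left₀ (norm_nonneg _) hc 2
    nlinarith [sq_nonneg (g h).re, sq_nonneg (g h).im]
  by_contra hne
  -- This `t` turns the left side of `key` into `‖h‖² + 1`, which exceeds its bound.
  have := key ((‖h‖ ^ 2 + 1) / (2 * (g h).im))
  have e : 2 * ((‖h‖ ^ 2 + 1) / (2 * (g h).im)) * (g h).im = ‖h‖ ^ 2 + 1 := by
    field_simp
  linarith

section Order

attribute [local instance] CStarAlgebra.spectralOrder CStarAlgebra.spectralOrderedRing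

/-- From `0 ≤ p ≤ ‖p‖` one gets `‖‖p‖ - p‖ ≤ ‖p‖`. Hence `g p` lies in the disc of radius `‖p‖`
about `‖p‖`, where real parts are nonnegative. -/
theorem apply_star_mul_self_nonneg (g : StrongDual ℂ A) (hg : ‖g‖ ≤ 1) (h1 : g 1 = 1) (a : A) :
    0 ≤ g (star a * a) := by
  set p := star a * a with hp
  have hp0 : 0 ≤ p := star_mul_self_nonneg a
  have hsa : IsSelfAdjoint p := .star_mul_self a
  have hn : ‖algebraMap ℝ A ‖p‖ - p‖ ≤ ‖p‖ := by
    refine CStarAlgebra.norm_le_norm_of_nonneg_of_le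
      (sub_nonneg.2 hsa.le_algebraMap_norm_self) (sub_le_self _ hp0) |>.trans ?_
    rcases subsingleton_or_nontrivial A with hA | hA
    · rw [Subsingleton.elim (algebraMap ℝ A ‖p‖) 0, norm_zero]
      exact norm_nonneg _
    · simp
  have hv : g (algebraMap ℝ A ‖p‖ - p) = ‖p‖ - g p := by
    rw [map_sub, IsScalarTower.algebraMap_apply ℝ ℂ A, Algebra.algebraMap_eq_smul_one, map_smul,
      h1]
    simp
  have hle : ‖(‖p‖ : ℂ) - g p‖ ≤ ‖p‖ := by
    rw [← hv]
    exact ((g.le_opNorm _).trans (mul_le_of_le_one_left (norm_nonneg _) hg)).trans hn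
  have hre := (Complex.re_le_norm _).trans hle
  rw [Complex.sub_re, Complex.ofReal_re] at hre
  exact Complex.nonneg_iff.2 ⟨by linarith, (im_apply_eq_zero_of_isSelfAdjoint g hg h1 hsa).symm⟩

/-- A state from a norm-one functional of value one at the unit. -/
def CState.ofDual (g : StrongDual ℂ A) (hg : ‖g‖ ≤ 1) (h1 : g 1 = 1) : CState A where
  toLin := g
  nonneg := apply_star_mul_self_nonneg g hg h1
  map_one := h1

/-- The norm of a positive element belongs to its spectrum, and adding the unit shifts the spectrum
by one. -/
theorem norm_one_add_star_mul_self [Nontrivial A] (a : A) :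
    ‖1 + star a * a‖ = 1 + ‖star a * a‖ := by
  refine le_antisymm ((norm_add_le _ _).trans (by rw [CStarRing.norm_one])) ?_
  have h := CStarAlgebra.norm_mem_spectrum_of_nonneg (a := star a * a) (star_mul_self_nonneg a)
  have h2 : ‖star a * a‖ + 1 ∈ spectrum ℝ (algebraMap ℝ A 1 + star a * a) :=
    spectrum.add_mem_add_iff.2 h
  rw [map_one, add_comm ‖_‖] at h2
  have := spectrum.norm_le_norm_of_mem h2
  rwa [Real.norm_of_nonneg (by positivity)] at this

/-- Hahn–Banach is applied to `1 + a*a` instead of `a*a`: since the norms add up, a norming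
functional of the sum must norm both summands, so it takes the value one at the unit and is a state.
-/
theorem exists_state_star_mul_self [Nontrivial A] (a : A) :
    ∃ φ : CState A, φ.toLin (star a * a) = ‖star a * a‖ := by
  obtain ⟨g, hg, hv⟩ := exists_dual_vector'' ℂ (1 + star a * a)
  rw [norm_one_add_star_mul_self, map_add] at hv
  have b1 : ‖g 1‖ ≤ 1 := by
    simpa using (g.le_opNorm 1).trans (mul_le_of_le_one_left (norm_nonneg _) hg)
  have b2 : ‖g (star a * a)‖ ≤ ‖star a * a‖ :=
    (g.le_opNorm _).trans (mul_le_of_le_one_left (norm_nonneg _) hg)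
  have hre := congrArg Complex.re hv
  rw [Complex.add_re] at hre
  change _ = 1 + ‖star a * a‖ at hre
  have r1 := Complex.re_le_norm (g 1)
  have r2 := Complex.re_le_norm (g (star a * a))
  -- The two real parts are at most `1` and `‖a*a‖` and add up to `1 + ‖a*a‖`, so both bounds are
  -- attained.
  have e1 : (g 1).re = ‖g 1‖ := by linarith
  have h1 : g 1 = 1 := by
    rw [Complex.re_eq_norm] at e1
    rw [Complex.eq_re_of_ofReal_le e1]
    norm_cast
    linarith
  refine ⟨CState.ofDual g hg h1, ?_⟩
  change g (star a * a) = _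
  rw [h1] at hv
  simpa using hv

end Order

instance [Nontrivial A] : Nonempty (CState A) := (exists_state_star_mul_self (1 : A)).nonempty

theorem CState.nontrivial (φ : CState A) : Nontrivial A :=
  ⟨1, 0, fun h => one_ne_zero (φ.map_one.symm.trans (by rw [h, map_zero]))⟩

/-- A state attaining `‖a*a‖` is a vector state of the universal representation, so it vanishes on
`a*a` as soon as `a` is represented by zero. -/
theorem univRep_injective : Function.Injective (univRep A) := by
  rw [injective_iff_map_eq_zero]
  intro a ha
  rcases subsingleton_or_nontrivial A with hA | hA
  · exact Subsingleton.elim _ _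
  obtain ⟨φ, hφ⟩ := exists_state_star_mul_self a
  have h0 : univRep A (star a * a) = 0 := by rw [map_mul, ha, mul_zero]
  rw [← inner_stateVec, h0, zero_apply, inner_zero_right] at hφ
  rw [← CStarRing.star_mul_self_eq_zero_iff, ← norm_eq_zero]
  exact_mod_cast hφ.symm

theorem norm_univRep (a : A) : ‖univRep A a‖ = ‖a‖ :=
  NonUnitalStarAlgHom.norm_map (univRep A) univRep_injective a

instance [Nontrivial A] : Nontrivial (UHilb A) := by
  obtain ⟨φ⟩ : Nonempty (CState A) := inferInstance
  refine ⟨stateVec φ, 0, fun h => one_ne_zero (α := ℂ) ?_⟩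
  rw [← φ.map_one, ← inner_stateVec, h, inner_zero_left]

end States

/-! ### Operators on Hilbert tensor products -/

section HilbertTensor

variable {H K L : Type u} [NormedAddCommGroup H] [InnerProductSpace ℂ H]
  [NormedAddCommGroup K] [InnerProductSpace ℂ K] [NormedAddCommGroup L] [InnerProductSpace ℂ L]

theorem norm_vtens (ξ : H) (η : K) : ‖vtens ξ η‖ = ‖ξ‖ * ‖η‖ := by
  rw [vtens, LinearIsometry.norm_map, TensorProduct.norm_tmul]

theorem inner_vtens (ξ ξ' : H) (η η' : K) :
    ⟪vtens ξ η, vtens ξ' η'⟫_ℂ = ⟪ξ, ξ'⟫_ℂ * ⟪η, η'⟫_ℂ := by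
  rw [vtens, vtens, LinearIsometry.inner_map_map, TensorProduct.inner_tmul]

theorem ext_vtens {S T : HTens H K →L[ℂ] HTens H K}
    (h : ∀ ξ η, S (vtens ξ η) = T (vtens ξ η)) : S = T := by
  refine ext_inc fun x => ?_
  induction x using TensorProduct.induction_on with
  | zero => simp
  | tmul ξ η => exact h ξ η
  | add a b ha hb => rw [map_add, map_add, map_add, ha, hb]

theorem eq_of_inner_vtens {x y : HTens H K}
    (h : ∀ ξ η, ⟪vtens ξ η, x⟫_ℂ = ⟪vtens ξ η, y⟫_ℂ) : x = y := by
  have hi : ∀ z : H ⊗[ℂ] K, ⟪inc H K z, x⟫_ℂ = ⟪inc H K z, y⟫_ℂ := by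
    intro z
    induction z using TensorProduct.induction_on with
    | zero => simp
    | tmul ξ η => exact h ξ η
    | add a b ha hb => rw [map_add, inner_add_left, inner_add_left, ha, hb]
  have hd := inc_dense (H := H) (K := K)
  have := hd.equalizer (continuous_id.inner continuous_const)
    (continuous_id.inner continuous_const) (funext hi)
  exact ext_inner_left ℂ fun v => congrFun this v

theorem opTens_mul (S S' : H →L[ℂ] H) (T T' : K →L[ℂ] K) :
    opTens (S * S') (T * T') = opTens S T * opTens S' T' :=
  ext_vtens fun ξ η => by
    rw [mul_apply_eq_comp, opTens_vtens, opTens_vtens, opTens_vtens, mul_apply_eq_comp,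
      mul_apply_eq_comp]

theorem opTens_one_one : opTens (1 : H →L[ℂ] H) (1 : K →L[ℂ] K) = 1 :=
  ext_vtens fun ξ η => by
    rw [opTens_vtens, one_apply_eq_self, one_apply_eq_self, one_apply_eq_self]

theorem opTens_star [CompleteSpace H] [CompleteSpace K] (S : H →L[ℂ] H) (T : K →L[ℂ] K) :
    opTens (star S) (star T) = star (opTens S T) :=
  ext_vtens fun ξ η => eq_of_inner_vtens fun ξ' η' => by
    rw [ContinuousLinearMap.star_eq_adjoint (A := opTens S T),
      ContinuousLinearMap.adjoint_inner_right, opTens_vtens, opTens_vtens, inner_vtens,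
      inner_vtens, ContinuousLinearMap.star_eq_adjoint, ContinuousLinearMap.star_eq_adjoint,
      ContinuousLinearMap.adjoint_inner_right, ContinuousLinearMap.adjoint_inner_right]

variable (H K) in
/-- The amplification `S ↦ S ⊗ 1`. -/
def ampLeft [CompleteSpace H] [CompleteSpace K] :
    (H →L[ℂ] H) →⋆ₐ[ℂ] (HTens H K →L[ℂ] HTens H K) where
  toFun S := opTens S 1
  map_one' := opTens_one_one
  map_mul' S S' := by rw [← opTens_mul, one_mul]
  map_zero' := by simpa using opTens_smul_left 0 (0 : H →L[ℂ] H) (1 : K →L[ℂ] K)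
  map_add' S S' := opTens_add_left S S' 1
  commutes' c := by
    rw [Algebra.algebraMap_eq_smul_one, opTens_smul_left, opTens_one_one,
      Algebra.algebraMap_eq_smul_one]
  map_star' S := by rw [← opTens_star, star_one]

variable (H K) in
/-- The amplification `T ↦ 1 ⊗ T`. -/
def ampRight [CompleteSpace H] [CompleteSpace K] :
    (K →L[ℂ] K) →⋆ₐ[ℂ] (HTens H K →L[ℂ] HTens H K) where
  toFun T := opTens 1 T
  map_one' := opTens_one_one
  map_mul' S S' := by rw [← opTens_mul, one_mul]
  map_zero' := by simpa using opTens_smul_right 0 (1 : H →L[ℂ] H) (0 : K →L[ℂ] K)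
  map_add' S S' := opTens_add_right 1 S S'
  commutes' c := by
    rw [Algebra.algebraMap_eq_smul_one, opTens_smul_right, opTens_one_one,
      Algebra.algebraMap_eq_smul_one]
  map_star' S := by rw [← opTens_star, star_one]

theorem ampLeft_injective [CompleteSpace H] [CompleteSpace K] [Nontrivial K] : Function.Injective (ampLeft H K) := by
  rw [injective_iff_map_eq_zero]
  intro S hS
  obtain ⟨η, hη⟩ := exists_ne (0 : K)
  ext ξ
  have h : vtens (S ξ) η = 0 := by
    have := opTens_vtens S 1 ξ η
    rw [one_apply_eq_self] at this
    rw [← this]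
    exact congrArg (fun T => T (vtens ξ η)) hS
  rw [← norm_eq_zero, norm_vtens, mul_eq_zero] at h
  simpa [hη] using h

theorem ampRight_injective [CompleteSpace H] [CompleteSpace K] [Nontrivial H] : Function.Injective (ampRight H K) := by
  rw [injective_iff_map_eq_zero]
  intro T hT
  obtain ⟨ξ, hξ⟩ := exists_ne (0 : H)
  ext η
  have h : vtens ξ (T η) = 0 := by
    have := opTens_vtens 1 T ξ η
    rw [one_apply_eq_self] at this
    rw [← this]
    exact congrArg (fun T => T (vtens ξ η)) hT
  rw [← norm_eq_zero, norm_vtens, mul_eq_zero] at h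
  simpa [hξ] using h

/-- Injective star homomorphisms of C*-algebras are isometric, so no estimate on tensors is needed.
-/
theorem norm_opTens_one_right [CompleteSpace H] [CompleteSpace K] [Nontrivial K] (S : H →L[ℂ] H) :
    ‖opTens S (1 : K →L[ℂ] K)‖ = ‖S‖ :=
  NonUnitalStarAlgHom.norm_map (ampLeft H K) ampLeft_injective S

theorem norm_opTens_one_left [CompleteSpace H] [CompleteSpace K] [Nontrivial H] (T : K →L[ℂ] K) :
    ‖opTens (1 : H →L[ℂ] H) T‖ = ‖T‖ :=
  NonUnitalStarAlgHom.norm_map (ampRight H K) ampRight_injective T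

/-! ### Leg embeddings and positivity -/

variable (H K L) in
/-- `leg12` as a homomorphism. -/
def legHom12 [CompleteSpace L] : (HTens H K →L[ℂ] HTens H K) →⋆ₐ[ℂ]
    (HTens H (HTens K L) →L[ℂ] HTens H (HTens K L)) :=
  ((assocU H K L).conjStarAlgEquiv.toStarAlgHom).comp (ampLeft (HTens H K) L)

variable (H K L) in
/-- `leg13` as a homomorphism. -/
def legHom13 [CompleteSpace K] : (HTens H L →L[ℂ] HTens H L) →⋆ₐ[ℂ]
    (HTens H (HTens K L) →L[ℂ] HTens H (HTens K L)) :=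
  ((congrU H (flipU L K)).conjStarAlgEquiv.toStarAlgHom).comp (legHom12 H L K)

theorem leg12_one [CompleteSpace L] : leg12 L (1 : HTens H K →L[ℂ] HTens H K) = 1 := map_one (legHom12 H K L)

theorem leg13_one [CompleteSpace K] : leg13 K (1 : HTens H L →L[ℂ] HTens H L) = 1 := map_one (legHom13 H K L)

theorem leg23_one [CompleteSpace H] : leg23 H (1 : HTens K L →L[ℂ] HTens K L) = 1 :=
  map_one (ampRight H (HTens K L))

theorem leg12_zero [CompleteSpace L] : leg12 L (0 : HTens H K →L[ℂ] HTens H K) = 0 := map_zero (legHom12 H K L)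

theorem leg13_zero [CompleteSpace K] : leg13 K (0 : HTens H L →L[ℂ] HTens H L) = 0 := map_zero (legHom13 H K L)

theorem leg23_zero [CompleteSpace H] : leg23 H (0 : HTens K L →L[ℂ] HTens K L) = 0 :=
  map_zero (ampRight H (HTens K L))

theorem leg12_nonneg [CompleteSpace L] {T : HTens H K →L[ℂ] HTens H K} (hT : 0 ≤ T) : 0 ≤ leg12 L T :=
  map_nonneg (legHom12 H K L) hT

theorem leg23_nonneg [CompleteSpace H] {T : HTens K L →L[ℂ] HTens K L} (hT : 0 ≤ T) : 0 ≤ leg23 H T :=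
  map_nonneg (ampRight H (HTens K L)) hT

theorem leg13_le_two [CompleteSpace K] {T : HTens H L →L[ℂ] HTens H L} (hT : T ≤ 2) : leg13 K T ≤ 1 + 1 := by
  have := OrderHomClass.mono (legHom13 H K L) hT
  rwa [map_ofNat, ← one_add_one_eq_two] at this

/-- With a unit vector `ξ` in the first leg, the quadratic form of `1 ⊗ T` at `ξ ⊗ ω` is that of `T`
at `ω`. -/
theorem nonneg_of_leg23_nonneg [Nontrivial H] {T : HTens K L →L[ℂ] HTens K L}
    (hT : 0 ≤ leg23 H T) : 0 ≤ T := by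
  rw [ContinuousLinearMap.nonneg_iff_isPositive, ContinuousLinearMap.isPositive_iff_complex]
    at hT ⊢
  obtain ⟨ξ, hξ⟩ := exists_norm_eq H (zero_le_one (α := ℝ))
  intro ω
  have h := hT (vtens ξ ω)
  have e : ⟪leg23 H T (vtens ξ ω), vtens ξ ω⟫_ℂ = ⟪T ω, ω⟫_ℂ := by
    rw [leg23, opTens_vtens, one_apply_eq_self, inner_vtens, inner_self_eq_norm_sq_to_K, hξ]
    simp
  rwa [e] at h

theorem flipU_flipU (x : HTens H K) : flipU K H (flipU H K x) = x := by
  have : (((flipU H K).trans (flipU K H)).toContinuousLinearEquiv :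
      HTens H K →L[ℂ] HTens H K) = 1 :=
    ext_vtens fun ξ η => by
      change flipU K H (flipU H K (vtens ξ η)) = vtens ξ η
      rw [flipU_vtens, flipU_vtens]
  exact congrArg (fun T => T x) this

theorem congrU_flip_flip (x : HTens H (HTens K L)) :
    congrU H (flipU L K) (congrU H (flipU K L) x) = x := by
  have : (((congrU H (flipU K L)).trans (congrU H (flipU L K))).toContinuousLinearEquiv :
      HTens H (HTens K L) →L[ℂ] HTens H (HTens K L)) = 1 :=
    ext_vtens fun ξ ω => by
      change congrU H (flipU L K) (congrU H (flipU K L) (vtens ξ ω)) = vtens ξ ω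
      rw [congrU_vtens, congrU_vtens, flipU_flipU]
  exact congrArg (fun T => T x) this

theorem conj_flip_leg23 (T : HTens L K →L[ℂ] HTens L K) :
    (congrU H (flipU L K)).conjStarAlgEquiv (leg23 H T) = leg23 H (flipOp T) :=
  ext_vtens fun ξ ω => by
    rw [LinearIsometryEquiv.conjStarAlgEquiv_apply_apply]
    have h : (congrU H (flipU L K)).symm (vtens ξ ω) = vtens ξ ((flipU L K).symm ω) := by
      rw [LinearIsometryEquiv.symm_apply_eq, congrU_vtens, LinearIsometryEquiv.apply_symm_apply]
    rw [h, leg23, opTens_vtens, congrU_vtens, leg23, opTens_vtens, flipOp,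
      LinearIsometryEquiv.conjStarAlgEquiv_apply_apply]

/-- `leg13` is by definition `leg12` conjugated by the reverse flip, and the two flips cancel. -/
theorem conj_flip_leg13 (T : HTens H L →L[ℂ] HTens H L) :
    (congrU H (flipU K L)).conjStarAlgEquiv (leg13 K T) = leg12 K T := by
  ext x
  have h : ∀ y : HTens H (HTens L K),
      (congrU H (flipU K L)).symm y = congrU H (flipU L K) y := by
    intro y
    rw [LinearIsometryEquiv.symm_apply_eq, congrU_flip_flip]
  rw [LinearIsometryEquiv.conjStarAlgEquiv_apply_apply, leg13,
    LinearIsometryEquiv.conjStarAlgEquiv_apply_apply, h, LinearIsometryEquiv.symm_apply_apply,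
    congrU_flip_flip]

/-- A flip-symmetric operator that satisfies the triangle inequality on three equal legs is
positive. -/
theorem nonneg_of_flip_of_triangle [CompleteSpace H] [Nontrivial H] {T : HTens H H →L[ℂ] HTens H H}
    (hf : T = flipOp T) (ht : leg13 H T ≤ leg12 H T + leg23 H T) : 0 ≤ T := by
  -- Flipping the last two legs exchanges legs 12 and 13 and, by the symmetry of `T`, fixes leg 23.
  have h := OrderHomClass.mono
    ((congrU H (flipU H H)).conjStarAlgEquiv.toStarAlgHom) ht
  have h' : leg12 H T ≤ leg13 H T + leg23 H T := by
    rw [map_add] at h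
    have e := conj_flip_leg23 (H := H) T
    rw [← hf] at e
    have e' := conj_flip_leg13 (H := H) (K := H) (L := H) T
    exact e' ▸ e ▸ h
  -- In the sum of the two inequalities the terms on legs 12 and 13 cancel, leaving twice leg 23.
  have hs : 0 ≤ leg23 H T + leg23 H T := by
    have := sub_nonneg.2 (add_le_add ht h')
    convert this using 1
    abel
  refine nonneg_of_leg23_nonneg (H := H) ?_
  rw [← two_smul ℝ] at hs
  have := smul_nonneg (inv_nonneg.2 (zero_le_two (α := ℝ))) hs
  rwa [smul_smul, inv_mul_cancel₀ two_ne_zero, one_smul] at this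

end HilbertTensor

/-! ### The one-point extension of a metric operator field -/

section Elementary

variable {A B : Type u} [CStarAlgebra A] [CStarAlgebra B]

theorem prodState_zero (φ : CState A) (ψ : CState B) : prodState φ ψ 0 = 0 := by
  rw [prodState, ZeroMemClass.coe_zero, zero_apply, inner_zero_right]

theorem norm_tmul_one [Nontrivial B] (a : A) : ‖tmul a (1 : B)‖ = ‖a‖ := by
  change ‖opTens (univRep A a) (univRep B 1)‖ = _
  rw [map_one, norm_opTens_one_right, norm_univRep]

theorem norm_one_tmul [Nontrivial A] (b : B) : ‖tmul (1 : A) b‖ = ‖b‖ := by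
  change ‖opTens (univRep A 1) (univRep B b)‖ = _
  rw [map_one, norm_opTens_one_left, norm_univRep]

theorem tmul_zero_one : tmul (0 : A) (1 : B) = 0 := by
  simpa using tmul_smul_left (0 : ℂ) (0 : A) (1 : B)

theorem tmul_one_zero : tmul (1 : A) (0 : B) = 0 := by
  simpa using tmul_smul_right (0 : ℂ) (1 : A) (0 : B)

theorem deLeeuw_of_eq_one {X : Type v} {A : X → Type u} [∀ x, CStarAlgebra (A x)] {D : Field₂ A}
    {x y : X} (h : D x y = 1) (f : ∀ x, A x) :
    deLeeuw D f x y = ((tmul (f x) 1 - tmul 1 (f y) : Spatial (A x) (A y)) :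
      TensOps (A x) (A y)) := by
  have : (1 : TensOps (A x) (A y)) ^ (-(1 / 2) : ℝ) = 1 := CFC.one_rpow
  rw [deLeeuw, h, OneMemClass.coe_one, this, one_mul, mul_one]

end Elementary

section Extension

variable {X : Type v} {A : X → Type u} [∀ x, CStarAlgebra (A x)] {D : Field₂ A}

theorem IsMof.nontrivial (hD : IsMof D) (x : X) : Nontrivial (A x) := by
  obtain ⟨μ, -⟩ := hD.1
  exact (μ x).nontrivial

/-- On the diagonal this is the triangle inequality at `x, x, x` together with flip symmetry. The
metric state makes the fibre, and hence its Hilbert space, nonzero. -/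
theorem IsMof.nonneg (hD : IsMof D) (x y : X) : 0 ≤ (D x y : TensOps (A x) (A y)) := by
  rcases eq_or_ne x y with rfl | h
  · have := hD.nontrivial x
    exact nonneg_of_flip_of_triangle (hD.2.2.1 x x) (hD.2.2.2 x x x)
  · exact (hD.2.1 x y h).1

/-- A self-adjoint operator is at most its norm; on the diagonal self-adjointness comes from
`IsMof.nonneg`. -/
theorem IsMof.le_two (hD : IsMof D) (hD2 : supNorm₂ D ≤ 2) (x y : X) :
    (D x y : TensOps (A x) (A y)) ≤ 2 := by
  have hn : ‖(D x y : TensOps (A x) (A y))‖ ≤ 2 := by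
    have h : ‖D x y‖ₑ ≤ 2 :=
      (le_iSup_of_le x (le_iSup (fun y => ‖D x y‖ₑ) y)).trans hD2
    rw [← ofReal_norm, ← ENNReal.ofReal_ofNat] at h
    exact (ENNReal.ofReal_le_ofReal_iff zero_le_two).1 h
  refine (IsSelfAdjoint.of_nonneg (hD.nonneg x y)).le_algebraMap_norm_self.trans ?_
  have := algebraMap_mono (TensOps (A x) (A y)) hn
  rwa [map_ofNat] at this

variable (B : Type u) [CStarAlgebra B]

theorem IsMof.mofPlus [Nontrivial B] (hD : IsMof D) (hD2 : supNorm₂ D ≤ 2) :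
    IsMof (mofPlus B D) := by
  refine ⟨?_, ?_, ?_, ?_⟩
  · obtain ⟨μ, hμ⟩ := hD.1
    -- Any state serves at `∞`, since `D⁺` vanishes there.
    obtain ⟨ν⟩ : Nonempty (CState B) := inferInstance
    refine ⟨fun p => match p with
      | none => ν
      | some x => μ x, fun p => ?_⟩
    match p with
    | none =>
      exact prodState_zero ν ν
    | some x => exact hμ x
  · intro p q h
    match p, q, h with
    | some x, some y, h => exact hD.2.1 x y fun e => h (congrArg some e)
    | some x, none, _ => exact ⟨zero_le_one' (TensOps (A x) B), isUnit_one⟩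
    | none, some x, _ => exact ⟨zero_le_one' (TensOps B (A x)), isUnit_one⟩
    | none, none, h => exact absurd rfl h
  · intro p q
    match p, q with
    | some x, some y => exact hD.2.2.1 x y
    | some x, none => exact (map_one (flipOp (H := UHilb B) (K := UHilb (A x)))).symm
    | none, some x => exact (map_one (flipOp (H := UHilb (A x)) (K := UHilb B))).symm
    | none, none => exact (map_zero (flipOp (H := UHilb B) (K := UHilb B))).symm
  · intro p q r
    match p, q, r with
    | some x, some y, some z => exact hD.2.2.2 x y z
    -- The only triple that uses the bound `‖D‖_∞ ≤ 2`.
    | some x, none, some z =>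
      change leg13 (UHilb B) (D x z : TensOps (A x) (A z)) ≤
        leg12 (UHilb (A z)) (1 : TensOps (A x) B) + leg23 (UHilb (A x)) (1 : TensOps B (A z))
      rw [leg12_one, leg23_one]
      exact leg13_le_two (hD.le_two hD2 x z)
    -- Here `x = y` is allowed, so positivity on the diagonal is needed.
    | some x, some y, none =>
      change leg13 (UHilb (A y)) (1 : TensOps (A x) B) ≤
        leg12 (UHilb B) (D x y : TensOps (A x) (A y)) + leg23 (UHilb (A x)) (1 : TensOps (A y) B)
      rw [leg13_one, leg23_one]
      exact le_add_of_nonneg_left (leg12_nonneg (hD.nonneg x y))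
    | none, some y, some z =>
      change leg13 (UHilb (A y)) (1 : TensOps B (A z)) ≤
        leg12 (UHilb (A z)) (1 : TensOps B (A y)) + leg23 (UHilb B) (D y z : TensOps (A y) (A z))
      rw [leg13_one, leg12_one]
      exact le_add_of_nonneg_right (leg23_nonneg (hD.nonneg y z))
    | some x, none, none =>
      change leg13 (UHilb B) (1 : TensOps (A x) B) ≤
        leg12 (UHilb B) (1 : TensOps (A x) B) + leg23 (UHilb (A x)) (0 : TensOps B B)
      rw [leg13_one, leg12_one, leg23_zero, add_zero]
    | none, none, some z =>
      change leg13 (UHilb B) (1 : TensOps B (A z)) ≤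
        leg12 (UHilb (A z)) (0 : TensOps B B) + leg23 (UHilb B) (1 : TensOps B (A z))
      rw [leg13_one, leg12_zero, leg23_one, zero_add]
    | none, some y, none =>
      change leg13 (UHilb (A y)) (0 : TensOps B B) ≤
        leg12 (UHilb B) (1 : TensOps B (A y)) + leg23 (UHilb B) (1 : TensOps (A y) B)
      rw [leg13_zero]
      exact add_nonneg (leg12_nonneg zero_le_one) (leg23_nonneg zero_le_one)
    | none, none, none =>
      change leg13 (UHilb B) (0 : TensOps B B) ≤
        leg12 (UHilb B) (0 : TensOps B B) + leg23 (UHilb B) (0 : TensOps B B)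
      rw [leg13_zero, leg12_zero, leg23_zero, zero_add]

/-! ### Restriction to `X` and its inverse -/

theorem enorm_deLeeuw_some_none [Nontrivial B] (f : ∀ p, bundlePlus A B p) (hf : f none = 0)
    (x : X) : ‖deLeeuw (Mof.mofPlus B D) f (some x) none‖ₑ = ‖restrictPlus A B f x‖ₑ := by
  rw [deLeeuw_of_eq_one (by rfl), hf, tmul_one_zero, sub_zero, enorm_eq_iff_norm_eq]
  exact norm_tmul_one (A := A x) (B := B) (f (some x))

theorem enorm_deLeeuw_none_some [Nontrivial B] (f : ∀ p, bundlePlus A B p) (hf : f none = 0)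
    (x : X) : ‖deLeeuw (Mof.mofPlus B D) f none (some x)‖ₑ = ‖restrictPlus A B f x‖ₑ := by
  rw [deLeeuw_of_eq_one (by rfl), hf, tmul_zero_one, zero_sub, NegMemClass.coe_neg, enorm_neg,
    enorm_eq_iff_norm_eq]
  exact norm_one_tmul (A := B) (B := A x) (f (some x))

/-- Pairs inside `X` contribute the seminorm of the restriction, and pairs meeting `∞` contribute
its supremum norm. -/
theorem lipNorm'_restrictPlus [Nontrivial B] (f : ∀ p, bundlePlus A B p) (hf : f none = 0) :
    lipNorm' D (restrictPlus A B f) = lipSeminorm (Mof.mofPlus B D) f := by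
  refine le_antisymm (max_le ?_ ?_) ?_
  · refine iSup_le fun x => iSup_le fun y => iSup_le fun h => ?_
    exact le_lipSeminorm (Mof.mofPlus B D) f (x := some x) (y := some y)
      fun e => h (Option.some.inj e)
  · refine iSup_le fun x => ?_
    rw [← enorm_deLeeuw_some_none (D := D) B f hf x]
    exact le_lipSeminorm (Mof.mofPlus B D) f (Option.some_ne_none x)
  · refine iSup_le fun p => iSup_le fun q => iSup_le fun h => ?_
    have hs : ∀ x, ‖restrictPlus A B f x‖ₑ ≤ lipNorm' D (restrictPlus A B f) := fun x =>
      le_max_of_le_right (le_iSup (fun x => ‖restrictPlus A B f x‖ₑ) x)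
    match p, q, h with
    | some x, some y, h =>
      exact le_max_of_le_left (le_lipSeminorm D (restrictPlus A B f) (x := x) (y := y)
        fun e => h (congrArg some e))
    | some x, none, _ => exact (enorm_deLeeuw_some_none B f hf x).trans_le (hs x)
    | none, some x, _ => exact (enorm_deLeeuw_none_some B f hf x).trans_le (hs x)
    | none, none, h => exact absurd rfl h

/-- Boundedness need not be required on `X⁺`: finiteness of the seminorm there is finiteness of a
maximum that includes the supremum norm on `X`. -/
theorem restrictPlus_mem_lipSpace_iff [Nontrivial B] {f : ∀ p, bundlePlus A B p}
    (hf : f none = 0) :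
    restrictPlus A B f ∈ lipSpace D ↔ f ∈ lipSpace₀ (Mof.mofPlus B D) none := by
  change supNorm _ < ⊤ ∧ lipSeminorm _ _ < ⊤ ↔ lipSeminorm _ _ < ⊤ ∧ f none = 0
  rw [← lipNorm'_restrictPlus B f hf, lipNorm', max_lt_iff]
  tauto

/-- At every pair meeting `∞` the extension is `1` or `0`, which commutes with everything, whatever
the value of `f` at `∞`. -/
theorem restrictPlus_mem_commSpace_iff (f : ∀ p, bundlePlus A B p) :
    restrictPlus A B f ∈ commSpace D ↔ f ∈ commSpace (Mof.mofPlus B D) := by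
  refine ⟨fun h p q => ?_, fun h x y => h (some x) (some y)⟩
  match p, q with
  | some x, some y => exact h x y
  | some x, none => exact Commute.one_left _
  | none, some x => exact Commute.one_left _
  | none, none => exact Commute.zero_left _

theorem restrictPlus_mem_lipAlg_iff [Nontrivial B] {f : ∀ p, bundlePlus A B p}
    (hf : f none = 0) :
    restrictPlus A B f ∈ lipAlg D ↔ f ∈ lipAlg₀ (Mof.mofPlus B D) none :=
  and_congr (restrictPlus_mem_lipSpace_iff B hf) (restrictPlus_mem_commSpace_iff B f)

/-- The extension of an operator field by zero at the point `∞`. -/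
def extendZero (g : ∀ x, A x) : ∀ p, bundlePlus A B p
  | none => (0 : B)
  | some x => g x

theorem extendZero_none (g : ∀ x, A x) : extendZero B g none = 0 := rfl

theorem extendZero_restrictPlus {f : ∀ p, bundlePlus A B p} (hf : f none = 0) :
    extendZero B (restrictPlus A B f) = f := by
  funext p
  match p with
  | none => exact hf.symm
  | some x => rfl

/-- Restriction to `X` as an equivalence between a space of fields that vanish at `∞` and the
space of their restrictions. -/
def restrictEquiv (S₀ : Submodule ℂ (∀ p, bundlePlus A B p)) (S : Submodule ℂ (∀ x, A x))
    (h₀ : ∀ f ∈ S₀, f none = 0)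
    (h : ∀ f : ∀ p, bundlePlus A B p, f none = 0 → (restrictPlus A B f ∈ S ↔ f ∈ S₀)) :
    S₀ ≃ₗ[ℂ] S where
  __ := (restrictPlus A B).restrict fun f hf => (h f (h₀ f hf)).2 hf
  invFun g := ⟨extendZero B g.1, (h (extendZero B g.1) (extendZero_none B g.1)).1 g.2⟩
  left_inv f := Subtype.ext (extendZero_restrictPlus B (h₀ f f.2))
  right_inv _ := rfl

end Extension

end Mof

end

theorem mainTheorem12 {X : Type v} (A : X → Type u) [∀ x, CStarAlgebra (A x)]
    (D : Mof.Field₂ A) (hD : Mof.IsMof D) (hD2 : Mof.supNorm₂ D ≤ 2)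
    (B : Type u) [CStarAlgebra B] [Nontrivial B] :
    Mof.IsMof (Mof.mofPlus B D) ∧
    (∃ e : Mof.lipSpace₀ (Mof.mofPlus B D) none ≃ₗ[ℂ] Mof.lipSpace D,
      ∀ f, (e f : ∀ x, A x) = Mof.restrictPlus A B f ∧
        Mof.lipNorm' D (e f) = Mof.lipSeminorm (Mof.mofPlus B D) f) ∧
    (∃ e : Mof.lipAlg₀ (Mof.mofPlus B D) none ≃ₗ[ℂ] Mof.lipAlg D,
      ∀ f, (e f : ∀ x, A x) = Mof.restrictPlus A B f ∧
        Mof.lipNorm' D (e f) = Mof.lipSeminorm (Mof.mofPlus B D) f) :=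
  ⟨hD.mofPlus B hD2,
    ⟨Mof.restrictEquiv B (Mof.lipSpace₀ (Mof.mofPlus B D) none) (Mof.lipSpace D)
        (fun _ hf => hf.2) fun _ hf => Mof.restrictPlus_mem_lipSpace_iff B hf,
      fun f => ⟨rfl, Mof.lipNorm'_restrictPlus B f.1 f.2.2⟩⟩,
    ⟨Mof.restrictEquiv B (Mof.lipAlg₀ (Mof.mofPlus B D) none) (Mof.lipAlg D)
        (fun _ hf => hf.1.2) fun _ hf => Mof.restrictPlus_mem_lipAlg_iff B hf,
      fun f => ⟨rfl, Mof.lipNorm'_restrictPlus B f.1 f.2.1.2⟩⟩⟩
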